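/- Let $\mathfrak{A}$ be a unital $C^*$-algebra. A *$*$-derivation* in $\mathfrak{A}$ is a linear map $\delta\colon\mathcal{D}(\delta)\to\mathfrak{A}$, whose domain $\mathcal{D}(\delta)$ is a dense $*$-subalgebra of $\mathfrak{A}$ containing the identity, such that $\delta(ab)=\delta(a)b+a\delta(b)$ and $\delta(a^*)=\delta(a)^*$ for all $a,b\in\mathcal{D}(\delta)$. It is *well behaved* if for every positive $a\in\mathcal{D}(\delta)$ there is a state $\phi$ on $\mathfrak{A}$ with $\phi(a)=\|a\|$ and $\phi(\delta(a))=0$. For $n\ge 1$ let $\delta_n=\delta\otimes\mathrm{id}_n$ be the operator in the $C^*$-algebra $\mathfrak{A}\otimes M_n$ of $n\times n$ matrices over $\mathfrak{A}$ given by $\delta_n((a_{ij}))=(\delta(a_{ij}))$, with domain the matrices $(a_{ij})$ all of whose entries lie in $\mathcal{D}(\delta)$. A linear operator $T$ with domain $\mathcal{D}(T)$ in a Banach space $X$ is *dissipative* if for every $x\in\mathcal{D}(T)$ there is $f\in X'$ with $\|f\|=1$, $f(x)=\|x\|$ and $\operatorname{Re}f(T(x))\le 0$; an operator $\delta$ in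 $\mathfrak{A}$ is *completely dissipative* if $\delta_n$ is dissipative in $\mathfrak{A}\otimes M_n$ for every $n\ge 1$. **Theorem.** Let $\delta$ be a well-behaved $*$-derivation in a unital $C^*$-algebra $\mathfrak{A}$. Then $\delta$ is well behaved in the matricial sense, that is, for every $n=1,2,\dots$ the operator $\delta_n=\delta\otimes\mathrm{id}_n$ is a well-behaved $*$-derivation in $\mathfrak{A}\otimes M_n$. Moreover, both $\delta$ and $-\delta$ are completely dissipative. -/

import Mathlib

open scoped ComplexOrder

noncomputable section

/-- A state on a unital C*-algebra: a positive linear functional taking the value `1` at `1`. -/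
def IsState {A : Type*} [CStarAlgebra A] [PartialOrder A] [StarOrderedRing A]
    (φ : A →ₚ[ℂ] ℂ) : Prop :=
  φ 1 = 1

/-- An (unbounded) *-derivation in a unital C*-algebra `A`: a linear map into `A` whose domain
is a dense *-subalgebra containing the identity, and which satisfies the Leibniz rule and
commutes with the involution. -/
structure IsStarDerivation {A : Type*} [CStarAlgebra A] (δ : A →ₗ.[ℂ] A) : Prop where
  dense_domain : Dense (δ.domain : Set A)
  one_mem : (1 : A) ∈ δ.domain
  map_mul : ∀ a b : δ.domain, ∃ h : (a : A) * (b : A) ∈ δ.domain,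
    δ ⟨(a : A) * (b : A), h⟩ = δ a * (b : A) + (a : A) * δ b
  map_star : ∀ a : δ.domain, ∃ h : star (a : A) ∈ δ.domain,
    δ ⟨star (a : A), h⟩ = star (δ a)

/-- A *-derivation is well behaved if every positive `a` in its domain admits a state `φ`
with `φ a = ‖a‖` and `φ (δ a) = 0`. -/
structure IsWellBehaved {A : Type*} [CStarAlgebra A] [PartialOrder A] [StarOrderedRing A]
    (δ : A →ₗ.[ℂ] A) : Prop extends IsStarDerivation δ where
  exists_state : ∀ a : δ.domain, 0 ≤ (a : A) →
    ∃ φ : A →ₚ[ℂ] ℂ, IsState φ ∧ φ (a : A) = ((‖(a : A)‖ : ℝ) : ℂ) ∧ φ (δ a) = 0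

/-- The operator `δ ⊗ id_n` in `A ⊗ M_n`, realized as the C*-algebra of `n × n` matrices over
`A`: its domain consists of the matrices with all entries in the domain of `δ`, and it applies
`δ` to each entry. -/
def ampliation {A : Type*} [CStarAlgebra A] (n : ℕ) (δ : A →ₗ.[ℂ] A) :
    CStarMatrix (Fin n) (Fin n) A →ₗ.[ℂ] CStarMatrix (Fin n) (Fin n) A where
  domain :=
    { carrier := {a | ∀ i j, a i j ∈ δ.domain}
      add_mem' := fun ha hb i j => δ.domain.add_mem (ha i j) (hb i j)
      zero_mem' := fun _ _ => δ.domain.zero_mem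
      smul_mem' := fun c _ ha i j => δ.domain.smul_mem c (ha i j) }
  toFun :=
    { toFun := fun a => CStarMatrix.ofMatrix fun i j => δ ⟨a.1 i j, a.2 i j⟩
      map_add' := fun a b => CStarMatrix.ext fun i j =>
        δ.toFun.map_add ⟨a.1 i j, a.2 i j⟩ ⟨b.1 i j, b.2 i j⟩
      map_smul' := fun c a => CStarMatrix.ext fun i j =>
        δ.toFun.map_smul c ⟨a.1 i j, a.2 i j⟩ }

/-- `δ` is well behaved in the matricial sense if each *-derivation `δ ⊗ id_n`, `n = 1, 2, …`,
is well behaved. -/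
def IsMatriciallyWellBehaved {A : Type*} [CStarAlgebra A] [PartialOrder A] [StarOrderedRing A]
    (δ : A →ₗ.[ℂ] A) : Prop :=
  ∀ n : ℕ, 1 ≤ n → IsWellBehaved (ampliation n δ)

/-- An operator in a Banach space is dissipative if every `x` in its domain admits a functional
`f` of norm one with `f x = ‖x‖` and `Re f (δ x) ≤ 0`. -/
def IsDissipative {X : Type*} [NormedAddCommGroup X] [NormedSpace ℂ X]
    (δ : X →ₗ.[ℂ] X) : Prop :=
  ∀ x : δ.domain, ∃ f : X →L[ℂ] ℂ,
    ‖f‖ = 1 ∧ f (x : X) = ((‖(x : X)‖ : ℝ) : ℂ) ∧ (f (δ x)).re ≤ 0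

/-- `δ` is completely dissipative if `δ ⊗ id_n` is dissipative for all `n = 1, 2, …`. -/
def IsCompletelyDissipative {A : Type*} [CStarAlgebra A] [PartialOrder A] [StarOrderedRing A]
    (δ : A →ₗ.[ℂ] A) : Prop :=
  ∀ n : ℕ, 1 ≤ n → IsDissipative (ampliation n δ)

end

/-! Let `G` be the closure of the graph of `δ` in the square-zero extension of `A` by itself: a
Banach algebra, whether or not `δ` is closable. For a positive matrix `a` over the domain, `c = ‖a‖
- a` has no left inverse, hence neither has the matrix `g` over `G` with entries `(c i j, δ (c i
j))`. So `g` has a kernel column `v` modulo a proper left ideal `N` of `G`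
(`Matrix.exists_ideal_forall_sum_mul_mem`), and some state `ω` kills the first components of `N`
(`IsStarDerivation.exists_isState_forall_mem`).

Let `p` be the first component of `v`. The element `w = v⋆ g v` of `N` has first component `p⋆ c p`,
killed by `ω`, and second component `p⋆ δ_n(c) p` plus cross terms, killed by Cauchy–Schwarz. Since
`ω` norms `‖w.fst‖ - w.fst`, it also kills `w.snd` (`IsWellBehaved.apply_snd_eq_zero`). Hence `x ↦ ω
(p⋆ x p)`, normalised, is the state required for `a`. Dissipativity of `±δ_n` follows by applying
this to `x⋆ x`. -/

/-! ### Cauchy–Schwarz and the construction of states -/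

section States

variable {A : Type*} [CStarAlgebra A] [PartialOrder A] [StarOrderedRing A]

theorem PositiveLinearMap.norm_apply_star_mul_sq_le (φ : A →ₚ[ℂ] ℂ) (x y : A) :
    ‖φ (star x * y)‖ ^ 2 ≤ (φ (star x * x)).re * (φ (star y * y)).re := by
  have h := norm_inner_le_norm (𝕜 := ℂ) (φ.toPreGNS x) (φ.toPreGNS y)
  have hx : ‖φ.toPreGNS x‖ ^ 2 = (φ (star x * x)).re := by
    have := congrArg Complex.re (φ.preGNS_norm_sq (φ.toPreGNS x))
    simpa [← Complex.ofReal_pow] using this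
  have hy : ‖φ.toPreGNS y‖ ^ 2 = (φ (star y * y)).re := by
    have := congrArg Complex.re (φ.preGNS_norm_sq (φ.toPreGNS y))
    simpa [← Complex.ofReal_pow] using this
  rw [φ.preGNS_inner_def] at h
  rw [← hx, ← hy, ← mul_pow]
  exact pow_le_pow_left₀ (norm_nonneg _) (by simpa using h) 2

theorem PositiveLinearMap.apply_mul_eq_zero (φ : A →ₚ[ℂ] ℂ) (x y : A)
    (h : φ (star y * y) = 0) : φ (x * y) = 0 := by
  have := φ.norm_apply_star_mul_sq_le (star x) y
  rw [h, star_star, Complex.zero_re, mul_zero] at this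
  simpa using this

theorem IsState.norm_apply_le {φ : A →ₚ[ℂ] ℂ} (hφ : IsState φ) (x : A) : ‖φ x‖ ≤ ‖x‖ := by
  have h := φ.norm_apply_star_mul_sq_le 1 x
  have h2 := φ.norm_apply_le_of_nonneg (star x * x) (star_mul_self_nonneg x)
  have h1 : φ 1 = 1 := hφ
  simp only [star_one, one_mul, h1, Complex.one_re] at h
  rw [h1, norm_one, one_mul, CStarRing.norm_star_mul_self] at h2
  have h3 := (Complex.re_le_norm _).trans h2
  exact (sq_le_sq₀ (norm_nonneg _) (norm_nonneg _)).1 (by nlinarith)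

theorem IsState.apply_re_le {φ : A →ₚ[ℂ] ℂ} (hφ : IsState φ) (x : A) : (φ x).re ≤ ‖x‖ :=
  (Complex.re_le_norm _).trans (hφ.norm_apply_le x)

/-- A functional of norm at most one that takes the value `1` at `1` is positive. -/
theorem ContinuousLinearMap.nonneg_of_norm_le_one (f : A →L[ℂ] ℂ) (hf : ‖f‖ ≤ 1) (h1 : f 1 = 1)
    {x : A} (hx : 0 ≤ x) : 0 ≤ f x := by
  have hb (y : A) : ‖f y‖ ≤ ‖y‖ := by
    simpa using (f.le_opNorm y).trans (mul_le_mul_of_nonneg_right hf (norm_nonneg y))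
  have : Nontrivial A := ⟨1, 0, fun h => by simp [h] at h1⟩
  have hsa : IsSelfAdjoint x := .of_nonneg hx
  have him : (f x).im = 0 := by
    -- Shifting `x` by `i t` moves the imaginary part by `t`, but adds at most `t ^ 2` to the bound
    -- on the squared norm.
    have key (t : ℝ) : ((f x).im + t) ^ 2 ≤ ‖x‖ ^ 2 + t ^ 2 := by
      have e : star (x + ((t : ℂ) * Complex.I) • (1 : A)) * (x + ((t : ℂ) * Complex.I) • (1 : A))
          = x * x + ((t ^ 2 : ℝ) : ℂ) • (1 : A) := by
        simp only [star_add, star_smul, star_one, hsa.star_eq, star_mul', Complex.star_def,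
          Complex.conj_I, Complex.conj_ofReal, add_mul, mul_add, smul_mul_assoc, mul_smul_comm,
          mul_one, one_mul, smul_add, smul_smul]
        have : (t : ℂ) * Complex.I * (t * -Complex.I) = ((t ^ 2 : ℝ) : ℂ) := by
          push_cast; linear_combination -(t : ℂ) ^ 2 * Complex.I_mul_I
        rw [this]
        module
      have h := hb (x + ((t : ℂ) * Complex.I) • (1 : A))
      have h' : ‖x + ((t : ℂ) * Complex.I) • (1 : A)‖ ^ 2 ≤ ‖x‖ ^ 2 + t ^ 2 := by
        rw [sq, ← CStarRing.norm_star_mul_self, e]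
        refine (norm_add_le _ _).trans (add_le_add ?_ ?_)
        · exact (norm_mul_le _ _).trans (sq _).ge
        · rw [norm_smul]
          simp
      have h2 : (f x).im + t = (f (x + ((t : ℂ) * Complex.I) • (1 : A))).im := by
        simp [h1]
      have h3 := (Complex.abs_im_le_norm _).trans h
      rw [← h2] at h3
      calc _ = |(f x).im + t| ^ 2 := (sq_abs _).symm
        _ ≤ _ := (pow_le_pow_left₀ (abs_nonneg _) h3 2).trans h'
    by_contra hne
    have := key ((‖x‖ ^ 2 + 1) / (f x).im)
    have e : (f x).im * ((‖x‖ ^ 2 + 1) / (f x).im) = ‖x‖ ^ 2 + 1 := by field_simp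
    nlinarith [sq_nonneg (f x).im, sq_nonneg ‖x‖]
  rw [Complex.nonneg_iff]
  refine ⟨?_, him.symm⟩
  have hn : ‖algebraMap ℝ A ‖x‖ - x‖ ≤ ‖x‖ := by
    rw [CStarAlgebra.norm_le_iff_le_algebraMap _ (norm_nonneg x)
      (sub_nonneg.2 hsa.le_algebraMap_norm_self)]
    simpa using hx
  have h := (Complex.re_le_norm _).trans ((hb _).trans hn)
  rw [map_sub, Algebra.algebraMap_eq_smul_one, ← Complex.coe_smul, map_smul, h1] at h
  simpa using h

/-- A subspace at distance at least one from the identity is annihilated by a state. -/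
theorem exists_isState_forall_mem_eq_zero (K : Submodule ℂ A) (hK : ∀ x ∈ K, 1 ≤ ‖1 - x‖) :
    ∃ φ : A →ₚ[ℂ] ℂ, IsState φ ∧ ∀ x ∈ K, φ x = 0 := by
  have hnt : Nontrivial A := by
    by_contra h
    rw [not_nontrivial_iff_subsingleton] at h
    have := hK 0 K.zero_mem
    rw [Subsingleton.elim (1 - 0 : A) 0, norm_zero] at this
    linarith
  have hle : ‖K.mkQ 1‖ ≤ 1 := (Submodule.Quotient.norm_mk_le K 1).trans (by simp)
  have hge : 1 ≤ ‖K.mkQ 1‖ := by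
    refine le_of_forall_pos_le_add fun ε hε => ?_
    obtain ⟨m, hm, hm'⟩ := Submodule.Quotient.norm_mk_lt (S := K) (K.mkQ 1) hε
    have : 1 - m ∈ K := by
      rw [← Submodule.Quotient.eq]; exact hm.symm
    have := hK _ this
    rw [sub_sub_cancel] at this
    linarith
  have h1 : ‖K.mkQ 1‖ = 1 := le_antisymm hle hge
  -- Hahn–Banach in the seminormed quotient by `K`, which need not be closed.
  obtain ⟨g, hg, hg1⟩ := exists_dual_vector ℂ (K.mkQ 1) (by rw [h1]; exact one_ne_zero)
  let f : A →L[ℂ] ℂ := LinearMap.mkContinuous (g.toLinearMap ∘ₗ K.mkQ) 1 fun x => by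
    have := (g.le_opNorm (K.mkQ x)).trans
      (mul_le_mul_of_nonneg_left (Submodule.Quotient.norm_mk_le K x) (norm_nonneg _))
    rw [hg] at this
    exact this
  have hf : ‖f‖ ≤ 1 := LinearMap.mkContinuous_norm_le _ zero_le_one _
  have hf1 : f 1 = 1 := by
    change g (K.mkQ 1) = 1
    rw [hg1, h1]; simp
  refine ⟨PositiveLinearMap.mk₀ f.toLinearMap fun x hx => f.nonneg_of_norm_le_one hf hf1 hx,
    hf1, fun x hx => ?_⟩
  change g (K.mkQ x) = 0
  rw [(K.mkQ_apply x), (Submodule.Quotient.mk_eq_zero K).2 hx, map_zero]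

end States

/-! ### Kernel vectors modulo a proper left ideal -/

section LeftIdeals

/-- A square matrix without left inverse has a nonzero kernel vector in the quotient of the
ring by some proper left ideal. -/
theorem Matrix.exists_ideal_forall_sum_mul_mem {R : Type*} [Ring R] {n : Type*} [Fintype n]
    [DecidableEq n] (c : Matrix n n R) (hc : ¬ ∃ d : Matrix n n R, d * c = 1) :
    ∃ (N : Ideal R) (v : n → R) (k : n), N ≠ ⊤ ∧ v k = 1 ∧ ∀ i, ∑ j, c i j * v j ∈ N := by
  have hspan : Submodule.span R (Set.range c) ≠ ⊤ := by
    intro htop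
    apply hc
    have h (i : n) : ∃ d : n → R, ∑ k, d k • c k = Pi.single i 1 := by
      have : (Pi.single i 1 : n → R) ∈ Submodule.span R (Set.range c) := htop ▸ Submodule.mem_top
      exact (Submodule.mem_span_range_iff_exists_fun R).1 this
    choose d hd using h
    refine ⟨Matrix.of d, ?_⟩
    ext i j
    have := congrFun (hd i) j
    simp only [Finset.sum_apply, Pi.smul_apply, smul_eq_mul] at this
    rw [Matrix.mul_apply, Matrix.one_apply]
    simp only [Matrix.of_apply, this, Pi.single_apply]
    simp [eq_comm]
  -- The quotient by a maximal submodule `Q` is simple, so any basis vector outside `Q` generates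
  -- it; the ideal `N` will be the annihilator of that generator.
  obtain ⟨Q, hQ, hle⟩ := (eq_top_or_exists_le_coatom _).resolve_left hspan
  obtain ⟨k, hk⟩ : ∃ k, (Pi.single k 1 : n → R) ∉ Q := by
    by_contra! h
    refine hQ.1 (eq_top_iff.2 fun x _ => ?_)
    rw [← Finset.univ_sum_single x]
    refine Q.sum_mem fun i _ => ?_
    simpa [← Pi.single_smul] using Q.smul_mem (x i) (h i)
  have hsup : Q ⊔ Submodule.span R {(Pi.single k 1 : n → R)} = ⊤ := by
    refine hQ.2 _ (lt_of_le_of_ne le_sup_left fun h => hk ?_)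
    rw [h]
    exact Submodule.mem_sup_right (Submodule.mem_span_singleton_self _)
  have hv (i : n) : ∃ r : R, (Pi.single i 1 : n → R) - r • Pi.single k 1 ∈ Q := by
    have : (Pi.single i 1 : n → R) ∈ Q ⊔ Submodule.span R {(Pi.single k 1 : n → R)} :=
      hsup ▸ Submodule.mem_top
    obtain ⟨q, hq, z, hz, hqz⟩ := Submodule.mem_sup.1 this
    obtain ⟨r, rfl⟩ := Submodule.mem_span_singleton.1 hz
    exact ⟨r, by rwa [← hqz, add_sub_cancel_right]⟩
  choose v hv using hv
  have hv' (i : n) : (Pi.single i 1 : n → R) - Function.update v k 1 i • Pi.single k 1 ∈ Q := by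
    rcases eq_or_ne i k with rfl | h
    · simp
    · rw [Function.update_of_ne h]; exact hv i
  refine ⟨Q.comap (LinearMap.toSpanSingleton R (n → R) (Pi.single k 1)), Function.update v k 1, k,
    ?_, by simp, fun i => ?_⟩
  · rw [Ideal.ne_top_iff_one]
    simpa using hk
  · rw [Submodule.mem_comap, LinearMap.toSpanSingleton_apply]
    have h1 : c i ∈ Q := hle (Submodule.subset_span ⟨i, rfl⟩)
    have h2 : ∑ j, c i j • ((Pi.single j 1 : n → R) - Function.update v k 1 j • Pi.single k 1) ∈ Q :=
      Q.sum_mem fun j _ => Q.smul_mem _ (hv' j)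
    have h3 : ∑ j, c i j • (Pi.single j 1 : n → R) = c i := by
      conv_rhs => rw [← Finset.univ_sum_single (c i)]
      simp [← Pi.single_smul]
    simp only [smul_sub, Finset.sum_sub_distrib, h3, smul_smul, ← Finset.sum_smul] at h2
    simpa using Q.sub_mem h1 h2

/-- In a complete normed ring, a proper left ideal contains no `x` for which a power of `1 - x`
has norm less than one. -/
theorem Ideal.one_le_norm_one_sub_pow {R : Type*} [NormedRing R] [CompleteSpace R] {N : Ideal R}
    (hN : N ≠ ⊤) {x : R} (hx : x ∈ N) (k : ℕ) : 1 ≤ ‖(1 - x) ^ k‖ := by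
  by_contra! h
  refine hN (N.eq_top_of_isUnit_mem (x := 1 - (1 - x) ^ k) ?_ (isUnit_one_sub_of_norm_lt_one h))
  rw [← geom_sum_mul_neg, sub_sub_cancel]
  exact N.mul_mem_left _ hx

end LeftIdeals

/-! ### The closed graph as a Banach algebra -/

noncomputable section

section Derivations

variable {A : Type*} [CStarAlgebra A] {δ : A →ₗ.[ℂ] A}

theorem IsStarDerivation.apply_one (h : IsStarDerivation δ) : δ ⟨1, h.one_mem⟩ = 0 := by
  obtain ⟨h1, h2⟩ := h.map_mul ⟨1, h.one_mem⟩ ⟨1, h.one_mem⟩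
  simp only [mul_one, one_mul] at h2
  simpa using h2

theorem IsStarDerivation.smul_one_mem (h : IsStarDerivation δ) (c : ℂ) :
    c • (1 : A) ∈ δ.domain :=
  δ.domain.smul_mem c h.one_mem

theorem IsStarDerivation.apply_smul_one (h : IsStarDerivation δ) (c : ℂ) :
    δ ⟨c • 1, h.smul_one_mem c⟩ = 0 := by
  have := δ.map_smul c ⟨1, h.one_mem⟩
  rw [h.apply_one, smul_zero] at this
  exact this

/-- The graph of a *-derivation, as a subalgebra of the trivial square-zero extension. -/
def IsStarDerivation.graphAlgebra (h : IsStarDerivation δ) :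
    Subalgebra ℂ (TrivSqZeroExt A A) where
  carrier := {x | ∃ a : δ.domain, x.fst = a ∧ x.snd = δ a}
  mul_mem' := by
    rintro x y ⟨a, ha, ha'⟩ ⟨b, hb, hb'⟩
    obtain ⟨hm, hab⟩ := h.map_mul a b
    refine ⟨⟨a * b, hm⟩, by simp [ha, hb], ?_⟩
    rw [hab, TrivSqZeroExt.snd_mul, ha, ha', hb, hb', add_comm]
    simp
  add_mem' := by
    rintro x y ⟨a, ha, ha'⟩ ⟨b, hb, hb'⟩
    exact ⟨a + b, by simp [ha, hb], by simp [ha', hb', δ.map_add]⟩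
  algebraMap_mem' c :=
    ⟨⟨c • 1, h.smul_one_mem c⟩, by
      simp [Algebra.algebraMap_eq_smul_one], by
      rw [h.apply_smul_one]; simp [TrivSqZeroExt.algebraMap_eq_inl']⟩

/-- The closure of the graph of a *-derivation, a Banach algebra. -/
def IsStarDerivation.closedGraph (h : IsStarDerivation δ) :
    Subalgebra ℂ (TrivSqZeroExt A A) :=
  h.graphAlgebra.topologicalClosure

theorem IsStarDerivation.mk_mem_closedGraph (h : IsStarDerivation δ) (a : δ.domain) :
    ((a, δ a) : TrivSqZeroExt A A) ∈ h.closedGraph :=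
  h.graphAlgebra.le_topologicalClosure ⟨a, rfl, rfl⟩

instance (h : IsStarDerivation δ) : CompleteSpace h.closedGraph :=
  h.graphAlgebra.isClosed_topologicalClosure.completeSpace_coe

/-- The involution applied to both components. -/
def TrivSqZeroExt.starBoth (x : TrivSqZeroExt A A) : TrivSqZeroExt A A :=
  (star x.fst, star x.snd)

theorem IsStarDerivation.starBoth_mem_closedGraph (h : IsStarDerivation δ)
    {x : TrivSqZeroExt A A} (hx : x ∈ h.closedGraph) : x.starBoth ∈ h.closedGraph := by
  have hc : Continuous (TrivSqZeroExt.starBoth : TrivSqZeroExt A A → TrivSqZeroExt A A) :=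
    (TrivSqZeroExt.continuous_fst.star).prodMk (TrivSqZeroExt.continuous_snd.star)
  refine map_mem_closure hc hx ?_
  rintro y ⟨a, ha, ha'⟩
  obtain ⟨hm, hs⟩ := h.map_star a
  exact ⟨⟨star a, hm⟩, congrArg star ha, (congrArg star ha').trans hs.symm⟩

theorem IsStarDerivation.exists_near (h : IsStarDerivation δ)
    {x : TrivSqZeroExt A A} (hx : x ∈ h.closedGraph) {ε : ℝ} (hε : 0 < ε) :
    ∃ a : δ.domain, ‖x.fst - a‖ < ε ∧ ‖x.snd - δ a‖ < ε := by
  obtain ⟨y, ⟨a, ha, ha'⟩, hy⟩ := Metric.mem_closure_iff.1 hx ε hε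
  rw [dist_eq_norm, TrivSqZeroExt.norm_def, TrivSqZeroExt.fst_sub, TrivSqZeroExt.snd_sub,
    ha, ha'] at hy
  exact ⟨a, by linarith [norm_nonneg (x.snd - δ a)], by linarith [norm_nonneg (x.fst - a)]⟩

theorem IsStarDerivation.exists_symm (h : IsStarDerivation δ) (a : δ.domain) :
    ∃ b : δ.domain, IsSelfAdjoint (b : A) ∧
      (b : A) = (1 / 2 : ℂ) • (a + star (a : A)) ∧ δ b = (1 / 2 : ℂ) • (δ a + star (δ a)) := by
  obtain ⟨hm, hs⟩ := h.map_star a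
  refine ⟨(1 / 2 : ℂ) • (a + ⟨star a, hm⟩), ?_, rfl, ?_⟩
  · simp [IsSelfAdjoint, add_comm]
  · rw [δ.map_smul, δ.map_add, hs]

theorem norm_sub_symm_le {x : A} (hx : IsSelfAdjoint x) (a : A) :
    ‖x - (1 / 2 : ℂ) • (a + star a)‖ ≤ ‖x - a‖ := by
  have : x - (1 / 2 : ℂ) • (a + star a) = (1 / 2 : ℂ) • ((x - a) + star (x - a)) := by
    rw [star_sub, hx.star_eq]; module
  rw [this, norm_smul]
  have h2 := norm_add_le (x - a) (star (x - a))
  rw [norm_star] at h2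
  have h3 : ‖(1 / 2 : ℂ)‖ = 1 / 2 := by norm_num
  rw [h3]
  linarith

theorem IsStarDerivation.exists_near_selfAdjoint (h : IsStarDerivation δ)
    {x : TrivSqZeroExt A A} (hx : x ∈ h.closedGraph) (h1 : IsSelfAdjoint x.fst)
    (h2 : IsSelfAdjoint x.snd) {ε : ℝ} (hε : 0 < ε) :
    ∃ a : δ.domain, IsSelfAdjoint (a : A) ∧ ‖x.fst - a‖ < ε ∧ ‖x.snd - δ a‖ < ε := by
  obtain ⟨a, ha, ha'⟩ := h.exists_near hx hε
  obtain ⟨b, hb, hb1, hb2⟩ := h.exists_symm a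
  refine ⟨b, hb, ?_, ?_⟩
  · rw [hb1]; exact (norm_sub_symm_le h1 _).trans_lt ha
  · rw [hb2]; exact (norm_sub_symm_le h2 _).trans_lt ha'

theorem IsStarDerivation.exists_selfAdjoint_near (h : IsStarDerivation δ)
    {y : A} (hy : IsSelfAdjoint y) {ε : ℝ} (hε : 0 < ε) :
    ∃ b : δ.domain, IsSelfAdjoint (b : A) ∧ ‖y - b‖ < ε := by
  obtain ⟨a, ha, ha'⟩ := Metric.mem_closure_iff.1 (h.dense_domain y) ε hε
  obtain ⟨b, hb, hb1, -⟩ := h.exists_symm ⟨a, ha⟩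
  rw [dist_eq_norm] at ha'
  exact ⟨b, hb, by rw [hb1]; exact (norm_sub_symm_le hy _).trans_lt ha'⟩

theorem IsStarDerivation.isSelfAdjoint_apply (h : IsStarDerivation δ) {a : δ.domain}
    (ha : IsSelfAdjoint (a : A)) : IsSelfAdjoint (δ a) := by
  obtain ⟨hm, hs⟩ := h.map_star a
  rw [IsSelfAdjoint, ← hs]
  congr 1
  exact Subtype.ext ha

variable [PartialOrder A] [StarOrderedRing A]

/-- The shift by `r` makes `a` positive, and the state norming `a + r` does not see `δ a`. The bound
then holds for every state `ω`, not only for the one supplied. -/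
theorem IsWellBehaved.add_le_norm (h : IsWellBehaved δ) {a : δ.domain}
    (ha : IsSelfAdjoint (a : A)) {r : ℝ} (hr : ‖(a : A)‖ ≤ r) (s : ℝ) {ω : A →ₚ[ℂ] ℂ}
    (hω : IsState ω) :
    (ω a).re + r ≤ ‖(a : A) + (r : ℂ) • 1 + (s : ℂ) • δ a‖ := by
  let b : δ.domain := a + ⟨(r : ℂ) • 1, h.smul_one_mem r⟩
  have hb : (b : A) = (a : A) + (r : ℂ) • 1 := rfl
  have hδb : δ b = δ a := by
    rw [δ.map_add, h.apply_smul_one, add_zero]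
  have hpos : 0 ≤ (b : A) := by
    rw [hb, Complex.coe_smul, ← Algebra.algebraMap_eq_smul_one, ← neg_le_iff_add_nonneg']
    have := ha.neg.le_algebraMap_norm_self
    rw [norm_neg] at this
    exact this.trans (algebraMap_mono A hr)
  obtain ⟨φ, hφ, hφb, hφδ⟩ := h.exists_state b hpos
  have h1 := hω.apply_re_le (b : A)
  have h2 := hφ.apply_re_le ((b : A) + (s : ℂ) • δ b)
  have hω1 : ω 1 = 1 := hω
  rw [map_add, map_smul, hφδ, smul_zero, add_zero, hφb, Complex.ofReal_re] at h2
  rw [hδb, hb] at h2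
  rw [hb, map_add, map_smul, hω1] at h1
  simp only [smul_eq_mul, mul_one, Complex.add_re, Complex.ofReal_re] at h1
  exact h1.trans h2

/-- `add_le_norm` for `a + s b` with `r = ‖a + s b‖`, which cancels. The auxiliary `b` is free, so
that it can later offset `δ a` while `δ b` enters only at order `s ^ 2`. -/
theorem IsWellBehaved.add_mul_le (h : IsWellBehaved δ) {a b : δ.domain}
    (ha : IsSelfAdjoint (a : A)) (hb : IsSelfAdjoint (b : A)) (s : ℝ) {ω : A →ₚ[ℂ] ℂ}
    (hω : IsState ω) :
    (ω a).re + s * (ω b).re ≤ ‖(a : A)‖ + |s| * ‖(b : A) + δ a‖ + s ^ 2 * ‖δ b‖ := by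
  have hsa : IsSelfAdjoint ((a + (s : ℂ) • b : δ.domain) : A) :=
    ha.add (.smul (Complex.conj_ofReal s) hb)
  set r := ‖((a + (s : ℂ) • b : δ.domain) : A)‖
  have h1 := h.add_le_norm hsa le_rfl s hω
  have hnt : ‖(1 : A)‖ ≤ 1 := by
    rcases subsingleton_or_nontrivial A with hA | hA
    · rw [Subsingleton.elim (1 : A) 0, norm_zero]; exact zero_le_one
    · exact norm_one.le
  have e : ((a + (s : ℂ) • b : δ.domain) : A) + (r : ℂ) • 1 + (s : ℂ) • δ (a + (s : ℂ) • b)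
      = (a + (r : ℂ) • 1) + ((s : ℂ) • (b + δ a) + ((s ^ 2 : ℝ) : ℂ) • δ b) := by
    rw [δ.map_add, δ.map_smul]
    push_cast
    module
  have e2 : ω ((a + (s : ℂ) • b : δ.domain) : A) = ω a + s * ω b := by
    simp
  rw [e, e2] at h1
  have h2 := norm_add_le ((a : A) + (r : ℂ) • 1) ((s : ℂ) • (b + δ a) + ((s ^ 2 : ℝ) : ℂ) • δ b)
  have h3 := norm_add_le (a : A) ((r : ℂ) • 1)
  have h4 := norm_add_le ((s : ℂ) • (b + δ a)) (((s ^ 2 : ℝ) : ℂ) • δ b)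
  rw [norm_smul, Complex.norm_real, Real.norm_of_nonneg (norm_nonneg _)] at h3
  rw [norm_smul, norm_smul, Complex.norm_real, Complex.norm_real, Real.norm_eq_abs,
    Real.norm_of_nonneg (sq_nonneg s)] at h4
  have h5 : r * ‖(1 : A)‖ ≤ r := mul_le_of_le_one_right (norm_nonneg _) hnt
  simp only [Complex.add_re, Complex.re_ofReal_mul] at h1
  linarith

/-- A state that norms a self-adjoint element `x` annihilates `y` whenever `(x, y)` lies in the
closure of the graph of a well-behaved *-derivation. -/
theorem IsWellBehaved.apply_snd_eq_zero (h : IsWellBehaved δ) {x : TrivSqZeroExt A A}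
    (hx : x ∈ h.closedGraph) (h1 : IsSelfAdjoint x.fst) (h2 : IsSelfAdjoint x.snd)
    {ω : A →ₚ[ℂ] ℂ} (hω : IsState ω) (hωx : ‖x.fst‖ ≤ (ω x.fst).re) : ω x.snd = 0 := by
  have key1 {b : δ.domain} (hb : IsSelfAdjoint (b : A)) (s : ℝ) :
      s * (ω b).re ≤ |s| * ‖(b : A) + x.snd‖ + s ^ 2 * ‖δ b‖ := by
    refine le_of_forall_pos_le_add fun ε hε => ?_
    have hs : 0 < 2 + |s| := by positivity
    obtain ⟨a, ha, ha1, ha2⟩ := h.exists_near_selfAdjoint hx h1 h2 (div_pos hε hs)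
    have e1 := h.add_mul_le ha hb s hω
    have e2 := hω.apply_re_le (x.fst - a)
    rw [map_sub, Complex.sub_re] at e2
    have e3 : ‖(a : A)‖ ≤ ‖x.fst‖ + ‖x.fst - a‖ := norm_le_norm_add_norm_sub _ _
    have e4 : ‖(b : A) + δ a‖ ≤ ‖(b : A) + x.snd‖ + ε / (2 + |s|) := by
      have : (b : A) + δ a = (b + x.snd) - (x.snd - δ a) := by abel
      rw [this]
      exact (norm_sub_le _ _).trans (by gcongr)
    have e5 := mul_le_mul_of_nonneg_left e4 (abs_nonneg s)
    have e6 : ε = 2 * (ε / (2 + |s|)) + |s| * (ε / (2 + |s|)) := by field_simp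
    linarith
  -- Divide by `s` of either sign and let `s` tend to zero; this removes `δ b`, so that `b` may then
  -- approach `-x.snd` in norm alone.
  have key2 {b : δ.domain} (hb : IsSelfAdjoint (b : A)) : |(ω b).re| ≤ ‖(b : A) + x.snd‖ := by
    refine le_of_forall_pos_le_add fun ε hε => ?_
    have hd : 0 < ‖δ b‖ + 1 := by positivity
    set t := ε / (‖δ b‖ + 1) with ht
    have htp : 0 < t := div_pos hε hd
    have e1 := key1 hb t
    have e2 := key1 hb (-t)
    rw [abs_neg, neg_sq] at e2
    rw [abs_of_pos htp] at e1 e2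
    have e3 : t * (‖δ b‖ + 1) = ε := by rw [ht]; field_simp
    rw [abs_le]
    constructor
    · refine le_of_mul_le_mul_left ?_ htp
      nlinarith
    · refine le_of_mul_le_mul_left ?_ htp
      nlinarith
  have key3 : |(ω x.snd).re| ≤ 0 := by
    refine le_of_forall_pos_le_add fun ε hε => ?_
    obtain ⟨b, hb, hb'⟩ := h.exists_selfAdjoint_near h2.neg (half_pos hε)
    have e1 := key2 hb
    have e2 : ‖(b : A) + x.snd‖ < ε / 2 := by
      rw [← norm_neg]; convert! hb' using 2; abel
    have e3 := (Complex.abs_re_le_norm _).trans (hω.norm_apply_le ((b : A) + x.snd))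
    rw [map_add, Complex.add_re] at e3
    have e4 := abs_sub ((ω b).re + (ω x.snd).re) (ω b).re
    rw [add_sub_cancel_left] at e4
    linarith
  have him : (ω x.snd).im = 0 := by
    rw [← Complex.conj_eq_iff_im, ← Complex.star_def, ← map_star ω, h2.star_eq]
  exact Complex.ext (abs_nonpos_iff.1 key3) him

/-- A proper left ideal of the closed graph of a *-derivation is annihilated by a state. -/
theorem IsStarDerivation.exists_isState_forall_mem (h : IsStarDerivation δ)
    {N : Ideal h.closedGraph} (hN : N ≠ ⊤) :
    ∃ φ : A →ₚ[ℂ] ℂ, IsState φ ∧ ∀ x ∈ N, φ (x : TrivSqZeroExt A A).fst = 0 := by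
  let f : h.closedGraph →ₗ[ℂ] A :=
    (TrivSqZeroExt.fstHom ℂ A A).toLinearMap ∘ₗ h.closedGraph.val.toLinearMap
  suffices hK : ∀ y ∈ (N.restrictScalars ℂ).map f, 1 ≤ ‖1 - y‖ by
    obtain ⟨φ, hφ, hz⟩ := exists_isState_forall_mem_eq_zero _ hK
    exact ⟨φ, hφ, fun x hx => hz _ (Submodule.mem_map_of_mem hx)⟩
  rintro _ ⟨x, hx, rfl⟩
  by_contra! hlt
  set u : h.closedGraph := 1 - x with hu
  set r := ‖(u : TrivSqZeroExt A A).fst‖ with hr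
  set t := ‖(u : TrivSqZeroExt A A).snd‖ with ht
  have hr1 : r < 1 := hlt
  -- The second component of a power grows only by a factor linear in the exponent, so `r < 1`
  -- forces the powers of `u` to zero in the graph norm.
  have hb (k : ℕ) : ‖((u : TrivSqZeroExt A A) ^ (k + 1)).fst‖ ≤ r ^ (k + 1) ∧
      ‖((u : TrivSqZeroExt A A) ^ (k + 1)).snd‖ ≤ (k + 1) * r ^ k * t := by
    induction k with
    | zero => simp [hr, ht]
    | succ k ih =>
      rw [pow_succ, TrivSqZeroExt.fst_mul, TrivSqZeroExt.snd_mul]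
      constructor
      · refine (norm_mul_le _ _).trans ?_
        rw [pow_succ r]
        exact mul_le_mul_of_nonneg_right ih.1 (norm_nonneg _)
      · refine (norm_add_le _ _).trans ?_
        have e1 := norm_mul_le ((u : TrivSqZeroExt A A) ^ (k + 1)).fst (u : TrivSqZeroExt A A).snd
        have e2 := norm_mul_le ((u : TrivSqZeroExt A A) ^ (k + 1)).snd (u : TrivSqZeroExt A A).fst
        have e3 := mul_le_mul_of_nonneg_right ih.1 (norm_nonneg (u : TrivSqZeroExt A A).snd)
        have e4 := mul_le_mul_of_nonneg_right ih.2 (norm_nonneg (u : TrivSqZeroExt A A).fst)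
        rw [← hr] at e2 e4
        rw [← ht] at e1 e3
        rw [smul_eq_mul, op_smul_eq_mul]
        push_cast
        have e5 : ((k : ℝ) + 1 + 1) * r ^ (k + 1) * t
            = r ^ (k + 1) * t + (k + 1) * r ^ k * t * r := by ring
        linarith
  have hlim : Filter.Tendsto (fun k : ℕ => r ^ (k + 1) + (k + 1) * r ^ k * t) Filter.atTop
      (nhds 0) := by
    have r0 : 0 ≤ r := norm_nonneg _
    have l1 := tendsto_pow_atTop_nhds_zero_of_lt_one r0 hr1
    have l2 := tendsto_self_mul_const_pow_of_lt_one r0 hr1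
    have l3 := (l1.mul_const r).add ((l2.add l1).mul_const t)
    simp only [zero_mul, add_zero] at l3
    refine l3.congr fun k => ?_
    ring
  obtain ⟨k, hk⟩ := (hlim.eventually_lt_const one_pos).exists
  have := Ideal.one_le_norm_one_sub_pow hN hx (k + 1)
  rw [← hu] at this
  change 1 ≤ ‖((u ^ (k + 1) : h.closedGraph) : TrivSqZeroExt A A)‖ at this
  rw [SubmonoidClass.coe_pow, TrivSqZeroExt.norm_def] at this
  linarith [(hb k).1, (hb k).2]

end Derivations

end

/-! ### Positivity, compressions and matrix derivations -/

noncomputable section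

section Nonneg

variable {B : Type*} [CStarAlgebra B] [PartialOrder B] [StarOrderedRing B]

theorem CStarAlgebra.exists_eq_star_mul_self {x : B} (hx : 0 ≤ x) : ∃ y, x = star y * y :=
  CStarAlgebra.nonneg_iff_eq_star_mul_self.1 hx

theorem CStarAlgebra.norm_smul_one_sub_nonneg {x : B} (hx : 0 ≤ x) : 0 ≤ (‖x‖ : ℂ) • 1 - x := by
  rw [Complex.coe_smul, ← Algebra.algebraMap_eq_smul_one, sub_nonneg]
  exact (IsSelfAdjoint.of_nonneg hx).le_algebraMap_norm_self

/-- A left inverse of a self-adjoint element is two-sided, by taking adjoints, whereas `‖a‖` lies in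
the spectrum of `a`. -/
theorem CStarAlgebra.not_exists_mul_norm_sub_eq_one [Nontrivial B] {a : B} (ha : 0 ≤ a) :
    ¬ ∃ d, d * ((‖a‖ : ℂ) • 1 - a) = 1 := by
  rintro ⟨d, hd⟩
  have hs : IsSelfAdjoint ((‖a‖ : ℂ) • 1 - a) := .of_nonneg (norm_smul_one_sub_nonneg ha)
  have hd' := congrArg star hd
  rw [star_mul, hs.star_eq, star_one] at hd'
  have := CStarAlgebra.norm_mem_spectrum_of_nonneg ha
  rw [spectrum.mem_iff, Algebra.algebraMap_eq_smul_one, ← Complex.coe_smul] at this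
  refine this ⟨⟨_, d, ?_, hd⟩, rfl⟩
  rwa [left_inv_eq_right_inv hd hd']

end Nonneg

section Matrices

variable {A : Type*} [CStarAlgebra A]

/-- The compression `v⋆ x v` of a matrix `x` by a column `v`. -/
def CStarMatrix.compress {n : ℕ} (v : Fin n → A) : CStarMatrix (Fin n) (Fin n) A →ₗ[ℂ] A where
  toFun x := ∑ i, ∑ j, star (v i) * (x i j * v j)
  map_add' x y := by
    simp [add_mul, mul_add, Finset.sum_add_distrib]
  map_smul' c x := by
    simp [Finset.smul_sum]

theorem CStarMatrix.compress_apply {n : ℕ} (v : Fin n → A) (x : CStarMatrix (Fin n) (Fin n) A) :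
    CStarMatrix.compress v x = ∑ i, ∑ j, star (v i) * (x i j * v j) := rfl

theorem CStarMatrix.compress_one {n : ℕ} (v : Fin n → A) :
    CStarMatrix.compress v 1 = ∑ i, star (v i) * v i := by
  simp [CStarMatrix.compress_apply, CStarMatrix.one_apply]

theorem CStarMatrix.star_compress {n : ℕ} (v : Fin n → A) (x : CStarMatrix (Fin n) (Fin n) A) :
    star (CStarMatrix.compress v x) = CStarMatrix.compress v (star x) := by
  simp only [CStarMatrix.compress_apply, CStarMatrix.star_apply, star_sum, star_mul, star_star,
    mul_assoc]
  exact Finset.sum_comm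

theorem CStarMatrix.compress_star_mul_self {n : ℕ} (v : Fin n → A)
    (y : CStarMatrix (Fin n) (Fin n) A) :
    CStarMatrix.compress v (star y * y) =
      ∑ k, star (∑ i, y k i * v i) * ∑ j, y k j * v j := by
  simp only [CStarMatrix.compress_apply, CStarMatrix.mul_apply, CStarMatrix.star_apply, star_sum,
    star_mul, Finset.sum_mul, Finset.mul_sum]
  rw [Finset.sum_comm_cycle]
  simp only [mul_assoc]
  refine Finset.sum_congr rfl fun k _ => ?_
  rw [Finset.sum_comm]

variable {δ : A →ₗ.[ℂ] A} {n : ℕ}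

theorem ampliation_apply (x : (ampliation n δ).domain) (i j : Fin n) :
    ampliation n δ x i j = δ ⟨x.1 i j, x.2 i j⟩ := rfl

theorem LinearPMap.exists_sum_mem {ι : Type*} (δ : A →ₗ.[ℂ] A) (s : Finset ι) (f : ι → A)
    (g : ι → A) (h : ∀ i, ∃ hi : f i ∈ δ.domain, δ ⟨f i, hi⟩ = g i) :
    ∃ hs : ∑ i ∈ s, f i ∈ δ.domain, δ ⟨∑ i ∈ s, f i, hs⟩ = ∑ i ∈ s, g i := by
  choose hf hg using h
  refine ⟨δ.domain.sum_mem fun i _ => hf i, ?_⟩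
  have : (⟨∑ i ∈ s, f i, δ.domain.sum_mem fun i _ => hf i⟩ : δ.domain)
      = ∑ i ∈ s, ⟨f i, hf i⟩ := by
    ext; simp
  rw [this]
  change δ.toFun _ = _
  rw [map_sum]
  exact Finset.sum_congr rfl fun i _ => hg i

variable [PartialOrder A] [StarOrderedRing A]

theorem CStarMatrix.compress_nonneg {n : ℕ} (v : Fin n → A) {x : CStarMatrix (Fin n) (Fin n) A}
    (hx : 0 ≤ x) : 0 ≤ CStarMatrix.compress v x := by
  obtain ⟨y, rfl⟩ := CStarAlgebra.exists_eq_star_mul_self hx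
  rw [CStarMatrix.compress_star_mul_self]
  exact Finset.sum_nonneg fun k _ => star_mul_self_nonneg _

theorem IsStarDerivation.isStarDerivation_ampliation (h : IsStarDerivation δ) (n : ℕ) :
    IsStarDerivation (ampliation n δ) where
  dense_domain := by
    have : ((ampliation n δ).domain : Set (CStarMatrix (Fin n) (Fin n) A)) =
        (Set.univ.pi fun _ : Fin n => Set.univ.pi fun _ : Fin n => (δ.domain : Set A) :
          Set (Fin n → Fin n → A)) := by
      ext x
      exact ⟨fun hx i _ j _ => hx i j, fun hx i j => hx i trivial j trivial⟩
    rw [this]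
    exact dense_pi _ fun _ _ => dense_pi _ fun _ _ => h.dense_domain
  one_mem := fun i j => by
    rw [CStarMatrix.one_apply]
    split_ifs
    exacts [h.one_mem, δ.domain.zero_mem]
  map_mul a b := by
    have key (i j : Fin n) := LinearPMap.exists_sum_mem δ Finset.univ
      (fun k => a.1 i k * b.1 k j)
      (fun k => δ ⟨a.1 i k, a.2 i k⟩ * b.1 k j + a.1 i k * δ ⟨b.1 k j, b.2 k j⟩)
      fun k => h.map_mul ⟨a.1 i k, a.2 i k⟩ ⟨b.1 k j, b.2 k j⟩
    refine ⟨fun i j => (key i j).1, CStarMatrix.ext fun i j => ?_⟩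
    rw [ampliation_apply, CStarMatrix.add_apply, CStarMatrix.mul_apply, CStarMatrix.mul_apply,
      ← Finset.sum_add_distrib]
    exact (key i j).2
  map_star a := by
    have key (i j : Fin n) := h.map_star ⟨a.1 j i, a.2 j i⟩
    exact ⟨fun i j => (key i j).1, CStarMatrix.ext fun i j => (key i j).2⟩

end Matrices

end

/-! ### Well-behavedness of ampliations and dissipativity -/

noncomputable section

section Ampliations

variable {A : Type*} [CStarAlgebra A] [PartialOrder A] [StarOrderedRing A]
  {δ : A →ₗ.[ℂ] A} {n : ℕ}

/-- A positive matrix over the domain without left inverse is annihilated, together with its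
derivative, by a compression followed by a state. -/
theorem IsWellBehaved.exists_compress_eq_zero (h : IsWellBehaved δ) (c : (ampliation n δ).domain)
    (hc : 0 ≤ (c : CStarMatrix (Fin n) (Fin n) A))
    (hinv : ¬ ∃ d, d * (c : CStarMatrix (Fin n) (Fin n) A) = 1) :
    ∃ (ω : A →ₚ[ℂ] ℂ) (p : Fin n → A) (k : Fin n), IsState ω ∧ p k = 1 ∧
      ω (CStarMatrix.compress p c.1) = 0 ∧
      ω (CStarMatrix.compress p (ampliation n δ c)) = 0 := by
  let g : Matrix (Fin n) (Fin n) h.closedGraph := Matrix.of fun i j =>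
    ⟨_, h.mk_mem_closedGraph ⟨c.1 i j, c.2 i j⟩⟩
  have hg1 (i j : Fin n) : (g i j : TrivSqZeroExt A A).fst = c.1 i j := rfl
  have hg2 (i j : Fin n) : (g i j : TrivSqZeroExt A A).snd = ampliation n δ c i j := rfl
  let f : h.closedGraph →+* A :=
    (TrivSqZeroExt.fstHom ℂ A A).toRingHom.comp h.closedGraph.val.toRingHom
  have hg : ¬ ∃ d : Matrix (Fin n) (Fin n) h.closedGraph, d * g = 1 := by
    rintro ⟨d, hd⟩
    have hd' := congrArg f.mapMatrix hd
    rw [map_mul, map_one] at hd'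
    exact hinv ⟨CStarMatrix.ofMatrix (f.mapMatrix d), hd'⟩
  obtain ⟨N, v, k, hN, hk, hv⟩ := Matrix.exists_ideal_forall_sum_mul_mem g hg
  obtain ⟨ω, hω, hωN⟩ := h.exists_isState_forall_mem hN
  let st (x : h.closedGraph) : h.closedGraph := ⟨_, h.starBoth_mem_closedGraph x.2⟩
  have hst1 (x : h.closedGraph) : (st x : TrivSqZeroExt A A).fst = star x.1.fst := rfl
  have hst2 (x : h.closedGraph) : (st x : TrivSqZeroExt A A).snd = star x.1.snd := rfl
  set p : Fin n → A := fun i => (v i).1.fst with hp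
  set q : Fin n → A := fun i => (v i).1.snd with hq
  set m : Fin n → h.closedGraph := fun i => ∑ j, g i j * v j with hm
  have hm1 (i : Fin n) : (m i).1.fst = ∑ j, c.1 i j * p j := by
    simp [hm, hp, hg1, TrivSqZeroExt.fst_sum]
  have hm2 (i : Fin n) : (m i).1.snd
      = ∑ j, (c.1 i j * q j + ampliation n δ c i j * p j) := by
    simp [hm, hp, hq, hg1, hg2, TrivSqZeroExt.snd_sum]
  set w : h.closedGraph := ∑ i, st (v i) * m i with hw
  have hw1 : w.1.fst = CStarMatrix.compress p c.1 := by
    simp [hw, TrivSqZeroExt.fst_sum, hst1, hm1, CStarMatrix.compress_apply, Finset.mul_sum, hp]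
  set S : A := ∑ i, star (q i) * (m i).1.fst with hS
  have hcs : IsSelfAdjoint c.1 := .of_nonneg hc
  have hSs : star S = ∑ i, ∑ j, star (p i) * (c.1 i j * q j) := by
    simp only [hS, hm1, Finset.mul_sum, star_sum, star_mul, star_star, mul_assoc]
    rw [Finset.sum_comm]
    simp only [← CStarMatrix.star_apply, hcs.star_eq]
  have hw2 : w.1.snd = CStarMatrix.compress p (ampliation n δ c) + (star S + S) := by
    rw [hSs]
    simp [hw, TrivSqZeroExt.snd_sum, hst1, hst2, hm2, CStarMatrix.compress_apply, Finset.mul_sum,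
      mul_add, Finset.sum_add_distrib, hS, hp, hq]
    abel
  -- `N` contains `st (m i) * m i`, so `ω` kills the square of `(m i).1.fst` and, by Cauchy–Schwarz,
  -- all its left multiples.
  have hωS : ω S = 0 := by
    rw [hS, map_sum]
    refine Finset.sum_eq_zero fun i _ => ω.apply_mul_eq_zero _ _ ?_
    exact hωN _ (N.mul_mem_left (st (m i)) (hv i))
  have hωw : ω w.1.fst = 0 := hωN _ (N.sum_mem fun i _ => N.mul_mem_left _ (hv i))
  have hw0 : 0 ≤ w.1.fst := hw1 ▸ CStarMatrix.compress_nonneg p hc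
  have hws : IsSelfAdjoint w.1.snd := by
    rw [hw2]
    refine .add ?_ (IsSelfAdjoint.star_add_self S)
    rw [IsSelfAdjoint, CStarMatrix.star_compress,
      ((h.isStarDerivation_ampliation n).isSelfAdjoint_apply hcs).star_eq]
  -- `ω` vanishes on `w.1.fst ≥ 0`, so it attains the norm on the reflected element `‖w.1.fst‖ -
  -- w.1.fst`.
  let b : TrivSqZeroExt A A := algebraMap ℂ _ (‖w.1.fst‖ : ℂ) - w.1
  have hb : b ∈ h.closedGraph := h.closedGraph.sub_mem (h.closedGraph.algebraMap_mem _) w.2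
  have e1 : b.fst = (‖w.1.fst‖ : ℂ) • 1 - w.1.fst := by
    rw [TrivSqZeroExt.fst_sub, TrivSqZeroExt.algebraMap_eq_inl', TrivSqZeroExt.fst_inl,
      Algebra.algebraMap_eq_smul_one]
  have e2 : b.snd = - w.1.snd := by
    rw [TrivSqZeroExt.snd_sub, TrivSqZeroExt.algebraMap_eq_inl', TrivSqZeroExt.snd_inl, zero_sub]
  have htan : ω b.snd = 0 := by
    have e3 := CStarAlgebra.norm_smul_one_sub_nonneg hw0
    have hω1 : ω 1 = 1 := hω
    refine h.apply_snd_eq_zero hb ?_ ?_ hω ?_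
    · rw [e1]; exact .of_nonneg e3
    · rw [e2]; exact hws.neg
    · rw [e1, map_sub, hωw, map_smul, hω1]
      have : ‖(‖w.1.fst‖ : ℂ) • 1 - w.1.fst‖ ≤ ‖w.1.fst‖ := by
        rw [CStarAlgebra.norm_le_iff_le_algebraMap _ (norm_nonneg _) e3, Complex.coe_smul,
          ← Algebra.algebraMap_eq_smul_one]
        simpa using hw0
      simpa using this
  refine ⟨ω, p, k, hω, by simp [hp, hk], hw1 ▸ hωw, ?_⟩
  rw [e2, hw2, map_neg, map_add, map_add, map_star, hωS] at htan
  simpa using htan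

theorem IsWellBehaved.nontrivial (h : IsWellBehaved δ) : Nontrivial A := by
  obtain ⟨φ, hφ, -⟩ := h.exists_state 0 le_rfl
  have h1 : φ 1 = 1 := hφ
  exact ⟨1, 0, fun h0 => by simp [h0] at h1⟩

theorem IsWellBehaved.isMatriciallyWellBehaved (h : IsWellBehaved δ) :
    IsMatriciallyWellBehaved δ := by
  intro n hn
  have hM := h.isStarDerivation_ampliation n
  refine ⟨hM, fun a ha => ?_⟩
  have := h.nontrivial
  have : Nonempty (Fin n) := ⟨⟨0, hn⟩⟩
  let c : (ampliation n δ).domain :=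
    ⟨((‖a.1‖ : ℝ) : ℂ) • 1, hM.smul_one_mem _⟩ - a
  have hδc : ampliation n δ c = - ampliation n δ a := by
    rw [LinearPMap.map_sub, hM.apply_smul_one, zero_sub]
  obtain ⟨ω, p, k, hω, hk, h1, h2⟩ := h.exists_compress_eq_zero c
    (CStarAlgebra.norm_smul_one_sub_nonneg ha)
    (CStarAlgebra.not_exists_mul_norm_sub_eq_one ha)
  set t : ℂ := ω (CStarMatrix.compress p 1) with ht
  have hω1 : ω 1 = 1 := hω
  -- The entry `p k = 1` keeps the normalising constant away from zero.
  have ht1 : 1 ≤ t := by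
    rw [ht, CStarMatrix.compress_one, ← hω1]
    refine OrderHomClass.mono ω ?_
    calc (1 : A) = star (p k) * p k := by simp [hk]
      _ ≤ _ := Finset.single_le_sum (f := fun i => star (p i) * p i)
        (fun i _ => star_mul_self_nonneg _) (Finset.mem_univ k)
  have ht0 : 0 < t := zero_lt_one.trans_le ht1
  let φ : CStarMatrix (Fin n) (Fin n) A →ₚ[ℂ] ℂ :=
    PositiveLinearMap.mk₀ (t⁻¹ • (ω.toLinearMap ∘ₗ CStarMatrix.compress p)) fun x hx =>
      mul_nonneg (inv_nonneg.2 ht0.le) (ω.map_nonneg (CStarMatrix.compress_nonneg p hx))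
  have hφ (x : CStarMatrix (Fin n) (Fin n) A) : φ x = t⁻¹ * ω (CStarMatrix.compress p x) := rfl
  refine ⟨φ, ?_, ?_, ?_⟩
  · change φ 1 = 1
    rw [hφ, ← ht, inv_mul_cancel₀ ht0.ne']
  · have hc : c.1 = ((‖a.1‖ : ℝ) : ℂ) • 1 - a.1 := rfl
    rw [hc, map_sub, map_sub, map_smul, map_smul, ← ht, sub_eq_zero] at h1
    rw [hφ, ← h1, smul_eq_mul, mul_left_comm, inv_mul_cancel₀ ht0.ne', mul_one]
  · rw [hδc, map_neg, map_neg, neg_eq_zero] at h2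
    rw [hφ, h2, mul_zero]

/-- The two-sided form of dissipativity of a well-behaved *-derivation. -/
theorem IsWellBehaved.exists_norming_functional {B : Type*} [CStarAlgebra B] [PartialOrder B]
    [StarOrderedRing B] {δ : B →ₗ.[ℂ] B} (h : IsWellBehaved δ) (x : δ.domain) :
    ∃ f : B →L[ℂ] ℂ, ‖f‖ = 1 ∧ f x = ((‖(x : B)‖ : ℝ) : ℂ) ∧ (f (δ x)).re = 0 := by
  have := h.nontrivial
  rcases eq_or_ne x 0 with rfl | hx
  · obtain ⟨f, hf, -⟩ := exists_dual_vector ℂ (1 : B) (by simp)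
    exact ⟨f, hf, by simp, by simp [δ.map_zero]⟩
  have hx0 : 0 < ‖(x : B)‖ := norm_pos_iff.2 fun h0 => hx (Subtype.ext h0)
  obtain ⟨hs, hs'⟩ := h.map_star x
  obtain ⟨hm, hm'⟩ := h.map_mul ⟨star x, hs⟩ x
  obtain ⟨φ, hφ, hφ1, hφ2⟩ := h.exists_state ⟨_, hm⟩ (star_mul_self_nonneg (x : B))
  simp only [CStarRing.norm_star_mul_self] at hφ1
  rw [hm', hs', map_add] at hφ2
  let g : B →ₗ[ℂ] ℂ := (‖(x : B)‖ : ℂ)⁻¹ • (φ.toLinearMap ∘ₗ LinearMap.mulLeft ℂ (star (x : B)))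
  have hg (y : B) : g y = (‖(x : B)‖ : ℂ)⁻¹ * φ (star (x : B) * y) := rfl
  have hb (y : B) : ‖g y‖ ≤ 1 * ‖y‖ := by
    rw [hg, norm_mul, norm_inv, Complex.norm_real, norm_norm, one_mul, inv_mul_le_iff₀ hx0]
    refine (hφ.norm_apply_le _).trans ((norm_mul_le _ _).trans ?_)
    rw [norm_star]
  have hgx : g x = ((‖(x : B)‖ : ℝ) : ℂ) := by
    rw [hg, hφ1]
    have : (‖(x : B)‖ : ℂ) ≠ 0 := by exact_mod_cast hx0.ne'
    push_cast
    field_simp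
  refine ⟨g.mkContinuous 1 hb, le_antisymm (g.mkContinuous_norm_le zero_le_one hb) ?_, hgx, ?_⟩
  · have := (g.mkContinuous 1 hb).le_opNorm (x : B)
    rw [LinearMap.mkContinuous_apply, hgx, Complex.norm_real, norm_norm] at this
    exact le_of_mul_le_mul_right (by simpa using this) hx0
  · change (g (δ x)).re = 0
    -- Up to a positive factor, this real part is half of `φ (δ (x⋆ x)) = 0`.
    rw [hg, ← Complex.ofReal_inv, Complex.re_ofReal_mul]
    have e : φ (star (δ x) * x) = star (φ (star (x : B) * δ x)) := by
      rw [← map_star φ, star_mul, star_star]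
    have e' := congrArg Complex.re hφ2
    rw [e] at e'
    simp only [Complex.add_re, Complex.star_def, Complex.conj_re, Complex.zero_re] at e'
    rw [mul_eq_zero]
    right
    linarith

end Ampliations

end

theorem theorem12 {A : Type*} [CStarAlgebra A] [PartialOrder A] [StarOrderedRing A]
    (δ : A →ₗ.[ℂ] A) (hδ : IsWellBehaved δ) :
    IsMatriciallyWellBehaved δ ∧ IsCompletelyDissipative δ ∧ IsCompletelyDissipative (-δ) := by
  refine ⟨hδ.isMatriciallyWellBehaved, fun n hn x => ?_, fun n hn x => ?_⟩
  · obtain ⟨f, h1, h2, h3⟩ := (hδ.isMatriciallyWellBehaved n hn).exists_norming_functional x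
    exact ⟨f, h1, h2, h3.le⟩
  · obtain ⟨f, h1, h2, h3⟩ := (hδ.isMatriciallyWellBehaved n hn).exists_norming_functional x
    refine ⟨f, h1, h2, ?_⟩
    have : ampliation n (-δ) x = - ampliation n δ x := rfl
    rw [this, map_neg, Complex.neg_re, h3, neg_zero]
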